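/- **Setting.** All graphs are finite and simple. For a connected graph $G$ with vertex set $V$, distance $\partial$, and a vertex $v$ of eccentricity $d$, put $G_i(v)=\{z:\partial(v,z)=i\}$. Let $E_i^*$ $(0\le i\le d)$ be the diagonal $V\times V$ matrix over $\mathbb C$ with $(z,z)$-entry $1$ if $\partial(v,z)=i$ and $0$ otherwise. The Terwilliger algebra $T=T(v)$ is the subalgebra of $\mathrm{Mat}_V(\mathbb C)$ generated by the adjacency matrix of $G$ and $E_0^*,\dots,E_d^*$. A $T$-module is a subspace $W\subseteq\mathbb C^V$ with $TW\subseteq W$. It is irreducible if $W\neq0$ and its only $T$-submodules are $0$ and $W$. Its endpoint is $\min\{i: E_i^*W\ne 0\}$, and it is thin if $\dim E_i^*W\le 1$ for all $i$. Two $T$-modules $W,W'$ are isomorphic if there is a linear isomorphism $\sigma:W\to W'$ with $\sigma B=B\sigma$ on $W$ for all $B\in T$. The shape of a walk $[x_0,\dots,x_j]$ with respect to $v$ is the word $t_1\cdots t_j$, where $t_k$ is $r$, $f$ or $\ell$ according to whether $\partial(v,x_k)-\partial(v,x_{k-1})$ is $1$, $0$ or $-1$. Let $r^m(y,z)$, $r^m\ell(y,z)$,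 $r^mf(y,z)$, $\ell r^m(y,z)$ be the numbers of walks from $y$ to $z$ of the shape $r^m$, $r^m\ell$, $r^mf$, $\ell r^m$ with respect to $v$. Abbreviate $r^m(z)=r^m(v,z)$, and similarly for the other shapes. The graph $G$ is pseudo-distance-regular around $v$ if, for its positive (Perron) eigenvector $\nu$, the three numbers $$\sum_{u'}\frac{\nu_{u'}}{\nu_u}\qquad\text{($u'$ running over the neighbours of $u$ in $G_{j}(v)$), for } j=i-1,\ i,\ i+1,$$ depend only on $i=\partial(v,u)$ and not on the choice of $u\in G_i(v)$. **Construction.** Let $\Gamma$ be a connected graph with vertex set $X$ which is pseudo-distance-regular around $x\in X$, and let $d$ be the eccentricity of $x$ in $\Gamma$. Let $\Sigma$ be a graph with vertex set $Y$. The graph $H=H(\Gamma,\Sigma)$ is obtained from the Cartesian product $\Gamma\square\Sigma$ by adding a new vertex $w$ and joining it to exactly the vertices $(x,y)$, $y\in Y$. **Proposition.** Suppose that $\Sigma$ is isomorphic to the complete graph $K_n$, $n\ge2$, and let $T=T(w)$ be the Terwilliger algebra of $H$ with respect to $w$. Let $d_H$ be the eccentricity of $w$ in $H$. 1. Up to isomorphism,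 $H$ has exactly one irreducible $T$-module with endpoint $1$, and this module is thin. 2. There exist scalars $\alpha_i,\beta_i\in\mathbb C$ $(0\le i\le d)$ such that, in $\Gamma$ and with respect to $x$, for all $0\le i\le d$ and all $z\in\Gamma_i(x)$, $$r^{i+1}\ell(z)=\alpha_i\,r^i(z),\qquad r^if(z)=\beta_i\,r^i(z).$$ For any such scalars put, for $1\le i\le d_H$, $$\kappa_i=\alpha_{i-1},\qquad \mu_i=0,\qquad \theta_i=\beta_{i-1}-1,\qquad \rho_i=1.$$ Then the following hold in $H$ with respect to $w$, where $D^i_j(w,u)=H_i(w)\cap H_j(u)$. For every $1\le i\le d_H$ and every neighbour $u$ of $w$: (a) for every $z\in D^i_{i+1}(w,u)\cup D^i_i(w,u)$, $$r^i\ell(u,z)=\mu_i\,\ell r^i(u,z),\qquad r^{i-1}f(u,z)=\rho_i\,\ell r^i(u,z);$$ (b) for every $z\in D^i_{i-1}(w,u)$, $$r^i\ell(u,z)=\kappa_i\,r^{i-1}(u,z)+\mu_i\,\ell r^i(u,z),\qquad r^{i-1}f(u,z)=\theta_i\,r^{i-1}(u,z)+\rho_i\,\ell r^i(u,z).$$ Moreover,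 $\rho_i=0$ for every $1\le i\le d_H$ for which $D^i_{i+1}(w,u)$ is nonempty for some neighbour $u$ of $w$ (so, as $\rho_i=1$, these sets are all empty). -/

import Mathlib

open scoped Matrix

namespace TerwAlg

/-! ### Walks of a given shape -/

/-- The three symbols occurring in the shape of a walk: raising `r`, flat `f`, lowering `l`. -/
inductive Symb where
  | r : Symb
  | f : Symb
  | l : Symb

section Walks

variable {V : Type*} (G : SimpleGraph V)

/-- The symbol of a step from `u` to an adjacent vertex `v`, with respect to the base vertex `x`.
In a connected graph the distances to `x` of adjacent vertices differ by at most one, so the last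
case is exactly `dist x v = dist x u - 1`. -/
noncomputable def stepSymb (x u v : V) : Symb :=
  if G.dist x v = G.dist x u + 1 then Symb.r
  else if G.dist x v = G.dist x u then Symb.f
  else Symb.l

/-- The shape of a walk with respect to the base vertex `x`. -/
noncomputable def shape (x : V) : {y z : V} → G.Walk y z → List Symb
  | _, _, SimpleGraph.Walk.nil => []
  | _, _, @SimpleGraph.Walk.cons _ _ u v _ _ p => stepSymb G x u v :: shape x p

/-- The number of walks from `y` to `z` having the shape `s` with respect to `x`. -/
noncomputable def numWalks (x : V) (s : List Symb) (y z : V) : ℕ :=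
  Set.ncard {p : G.Walk y z | shape G x p = s}

/-- `r^m (y, z)` with respect to `x`. -/
noncomputable def numR (x : V) (m : ℕ) (y z : V) : ℕ :=
  numWalks G x (List.replicate m Symb.r) y z

/-- `r^m ℓ (y, z)` with respect to `x`. -/
noncomputable def numRL (x : V) (m : ℕ) (y z : V) : ℕ :=
  numWalks G x (List.replicate m Symb.r ++ [Symb.l]) y z

/-- `r^m f (y, z)` with respect to `x`. -/
noncomputable def numRF (x : V) (m : ℕ) (y z : V) : ℕ :=
  numWalks G x (List.replicate m Symb.r ++ [Symb.f]) y z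

/-- `ℓ r^m (y, z)` with respect to `x`. -/
noncomputable def numLR (x : V) (m : ℕ) (y z : V) : ℕ :=
  numWalks G x (Symb.l :: List.replicate m Symb.r) y z

/-- The set `D^i_j(x, y)` of vertices at distance `i` from `x` and `j` from `y`. -/
def distSet (x y : V) (i j : ℕ) : Set V :=
  {z | G.dist x z = i ∧ G.dist y z = j}

/-- The scalars `κ_i, μ_i, θ_i, ρ_i` (`1 ≤ i ≤ d`, where `d` is the eccentricity of `x`)
satisfy the combinatorial conditions (a), (b) and the final condition on `ρ_i`, with respect
to the base vertex `x`. -/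
def CombConditions (x : V) (κ μ θ ρ : ℕ → ℂ) : Prop :=
  ∀ i : ℕ, 1 ≤ i → (i : ℕ∞) ≤ G.eccent x →
    (∀ y : V, G.Adj x y →
      (∀ z ∈ distSet G x y i (i + 1) ∪ distSet G x y i i,
        (numRL G x i y z : ℂ) = μ i * numLR G x i y z ∧
        (numRF G x (i - 1) y z : ℂ) = ρ i * numLR G x i y z) ∧
      (∀ z ∈ distSet G x y i (i - 1),
        (numRL G x i y z : ℂ) = κ i * numR G x (i - 1) y z + μ i * numLR G x i y z ∧
        (numRF G x (i - 1) y z : ℂ) = θ i * numR G x (i - 1) y z + ρ i * numLR G x i y z)) ∧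
    ((∃ y : V, G.Adj x y ∧ (distSet G x y i (i + 1)).Nonempty) → ρ i = 0)

/-- The scalars `α_i, β_i` (`0 ≤ i ≤ d`, where `d` is the eccentricity of `x`) satisfy
`r^{i+1} ℓ (z) = α_i r^i (z)` and `r^i f (z) = β_i r^i (z)` for all vertices `z` at distance `i`
from `x`, where walks start at `x` and shapes are taken with respect to `x`. -/
def LocalScalars (x : V) (α β : ℕ → ℂ) : Prop :=
  ∀ i : ℕ, (i : ℕ∞) ≤ G.eccent x → ∀ z : V, G.dist x z = i →
    (numRL G x (i + 1) x z : ℂ) = α i * numR G x i x z ∧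
    (numRF G x i x z : ℂ) = β i * numR G x i x z

end Walks

/-! ### Pseudo-distance-regularity around a vertex -/

section PseudoDistanceRegular

variable {V : Type*} [Fintype V] (G : SimpleGraph V)

open Classical in
/-- For a weight `ν` on the vertices: the sum of `ν v / ν u` over the neighbours `v` of `u`
that satisfy `P`. -/
noncomputable def weightedDeg (ν : V → ℝ) (u : V) (P : V → Prop) : ℝ :=
  ∑ v with G.Adj u v ∧ P v, ν v / ν u

open Classical in
/-- A connected graph is pseudo-distance-regular around `x` if, for its positive eigenvector `ν`,
the weighted intersection numbers `c*(u), a*(u), b*(u)` of a vertex `u` with respect to `x` only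
depend on the distance between `x` and `u`. By Perron-Frobenius a positive eigenvector of a
finite connected graph exists and is unique up to a positive factor, on which these numbers do
not depend. -/
def IsPseudoDistanceRegularAround (x : V) : Prop :=
  ∃ ν : V → ℝ, (∀ u, 0 < ν u) ∧ (∃ t : ℝ, (G.adjMatrix ℝ) *ᵥ ν = t • ν) ∧
    ∃ c a b : ℕ → ℝ, ∀ u : V,
      weightedDeg G ν u (fun v => G.dist x v + 1 = G.dist x u) = c (G.dist x u) ∧
      weightedDeg G ν u (fun v => G.dist x v = G.dist x u) = a (G.dist x u) ∧
      weightedDeg G ν u (fun v => G.dist x v = G.dist x u + 1) = b (G.dist x u)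

end PseudoDistanceRegular

/-! ### The Terwilliger algebra and its modules -/

section Algebra

variable {V : Type*} [Fintype V] [DecidableEq V] (G : SimpleGraph V)

open Classical in
/-- The adjacency matrix over `ℂ`. -/
noncomputable def adjM : Matrix V V ℂ := G.adjMatrix ℂ

/-- The `i`-th dual idempotent of `G` with respect to `x`
(it is zero if `i` exceeds the eccentricity of `x`). -/
noncomputable def dualIdem (x : V) (i : ℕ) : Matrix V V ℂ :=
  Matrix.diagonal fun y => if G.dist x y = i then 1 else 0

/-- The Terwilliger algebra `T(x)`: the subalgebra generated by the adjacency matrix and the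
dual idempotents. -/
noncomputable def terwilliger (x : V) : Subalgebra ℂ (Matrix V V ℂ) :=
  Algebra.adjoin ℂ ({adjM G} ∪ Set.range (dualIdem G x))

/-- `W` is a `T(x)`-module: a subspace of the standard module `V → ℂ` invariant under `T(x)`. -/
def IsTModule (x : V) (W : Submodule ℂ (V → ℂ)) : Prop :=
  ∀ B ∈ terwilliger G x, ∀ w ∈ W, B *ᵥ w ∈ W

/-- `W` is an irreducible `T(x)`-module. -/
def IsIrredTModule (x : V) (W : Submodule ℂ (V → ℂ)) : Prop :=
  IsTModule G x W ∧ W ≠ ⊥ ∧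
    ∀ U : Submodule ℂ (V → ℂ), IsTModule G x U → U ≤ W → U = ⊥ ∨ U = W

/-- The subspace `E*_i W`. -/
noncomputable def subcons (x : V) (W : Submodule ℂ (V → ℂ)) (i : ℕ) : Submodule ℂ (V → ℂ) :=
  W.map (dualIdem G x i).mulVecLin

/-- The endpoint `min {i | E*_i W ≠ 0}` of a nonzero `T(x)`-module `W`. -/
noncomputable def endpoint (x : V) (W : Submodule ℂ (V → ℂ)) : ℕ :=
  sInf {i | subcons G x W i ≠ ⊥}

/-- `W` is thin if every `E*_i W` has dimension at most one. -/
def IsThin (x : V) (W : Submodule ℂ (V → ℂ)) : Prop :=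
  ∀ i : ℕ, Module.finrank ℂ (subcons G x W i) ≤ 1

/-- The `T(x)`-modules `W` and `W'` are isomorphic: some linear isomorphism `σ : W → W'` satisfies
`σ (B w) = B (σ w)` for all `B ∈ T(x)` and `w ∈ W`. -/
def TIsomorphic (x : V) (W W' : Submodule ℂ (V → ℂ)) : Prop :=
  ∃ σ : W ≃ₗ[ℂ] W', ∀ B ∈ terwilliger G x, ∀ w v : W,
    (v : V → ℂ) = B *ᵥ (w : V → ℂ) → (σ v : V → ℂ) = B *ᵥ (σ w : V → ℂ)

end Algebra

/-! ### The construction `H(Γ, Σ)` -/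

section Construction

variable {X Y : Type*}

/-- The graph `H(Γ, Σ)`: the Cartesian product `Γ □ Σ` with one new vertex `none`, the vertex `w`,
which is adjacent precisely to the vertices `(x, y)` with `y` a vertex of `Σ`. -/
def graphH (Γ : SimpleGraph X) (S : SimpleGraph Y) (x : X) : SimpleGraph (Option (X × Y)) where
  Adj
    | some p, some q => (Γ.boxProd S).Adj p q
    | none, some q => q.1 = x
    | some p, none => p.1 = x
    | none, none => False
  symm := ⟨by
    rintro (_ | p) (_ | q) h
    · exact h
    · exact h
    · exact h
    · exact SimpleGraph.Adj.symm h⟩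
  loopless := ⟨by
    rintro (_ | p) h
    · exact h
    · exact (Γ.boxProd S).loopless.irrefl p h⟩

end Construction

end TerwAlg

/-! On `f ⊗ s` with `∑ s = 0` the adjacency matrix `J - I` of `K_n` acts as `-1`, and the new vertex
receives `f x * ∑ s = 0`. Hence the adjacency matrix of `H` acts as `A_Γ - 1` on the first factor
(`adjM_tensorMap`), while the dual idempotent with index `i + 1` acts as the one of `Γ` with index
`i`. Pseudo-distance-regularity makes the span of the restrictions of `ν` to the spheres of `Γ`
invariant; tensored with `s ≠ 0` it is a thin module, irreducible because the coefficients between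
consecutive nonempty spheres do not vanish. Conversely, a vector in the first layer of a module with
endpoint 1 is supported on the copies of `x`, so it is `δ_x ⊗ s`, and the vanishing of the zeroth
layer forces `∑ s = 0`; irreducibility identifies the module (`exists_eq_radialModule`). The action
on `f` does not depend on `s`, so all these modules are isomorphic.

For the counts, `r` and `ℓ` steps between old vertices stay in one copy of `Γ`, an `f` step either
stays in its copy or changes only the copy, and a walk of shape `ℓ r^i` from `(x, y)` passes through
the new vertex and may continue in any copy. The distance from `(x, y)` tells whether `(z, y')` lies
in the same copy, so the conditions reduce to counts in `Γ`. -/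

namespace TerwAlg

/-! ### Walk counts as entries of products of step matrices -/

section StepMatrices

variable {V : Type*} (G : SimpleGraph V)

/-- The first step and the tail of a walk whose shape starts with `t`. -/
def walkSplit (x : V) (t : Symb) (s : List Symb) : {y z : V} → (p : G.Walk y z) →
    shape G x p = t :: s →
      Σ v : {v : V // G.Adj y v ∧ stepSymb G x y v = t}, {p : G.Walk v z // shape G x p = s}
  | _, _, .nil, h => absurd h (List.cons_ne_nil _ _).symm
  | _, _, .cons (v := v) hv p, h =>
      ⟨⟨v, hv, (List.cons.inj h).1⟩, ⟨p, (List.cons.inj h).2⟩⟩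

/-- Walks whose shape starts with `t` decompose into a first step of type `t` and a tail. -/
noncomputable def walksConsEquiv (x : V) (t : Symb) (s : List Symb) (y z : V) :
    {p : G.Walk y z // shape G x p = t :: s} ≃
      Σ v : {v : V // G.Adj y v ∧ stepSymb G x y v = t}, {p : G.Walk v z // shape G x p = s} where
  toFun q := walkSplit G x t s q.1 q.2
  invFun q := ⟨SimpleGraph.Walk.cons q.1.2.1 q.2.1, by
    rw [shape, q.1.2.2, q.2.2]⟩
  left_inv := by
    rintro ⟨_ | ⟨hv, p⟩, h⟩
    · simp [shape] at h
    · rfl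
  right_inv := by
    rintro ⟨⟨v, hv, rfl⟩, ⟨p, rfl⟩⟩
    rfl

/-- Needed so that `Nat.card_sigma` applies to the decomposition by the first step. -/
theorem finite_walks_of_shape [Finite V] (x : V) (s : List Symb) (y z : V) :
    Finite {p : G.Walk y z // shape G x p = s} := by
  induction s generalizing y with
  | nil =>
    by_cases h : y = z
    · subst h
      refine @Finite.of_subsingleton _ ⟨?_⟩
      rintro ⟨_ | _, hp⟩ ⟨_ | _, hq⟩
      · rfl
      all_goals simp [shape] at hp hq
    · refine @Finite.of_subsingleton _ ⟨?_⟩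
      rintro ⟨_ | _, hp⟩
      · exact absurd rfl h
      · simp [shape] at hp
  | cons t s ih =>
    have := fun v : {v : V // G.Adj y v ∧ stepSymb G x y v = t} => ih v.1
    exact Finite.of_equiv _ (walksConsEquiv G x t s y z).symm

open Classical in
/-- The part of the adjacency matrix that consists of the steps of type `t`. -/
noncomputable def stepMatrix (x : V) (t : Symb) : Matrix V V ℂ :=
  Matrix.of fun y z => if G.Adj y z ∧ stepSymb G x y z = t then 1 else 0

open Classical in
theorem stepMatrix_apply (x : V) (t : Symb) (y z : V) :
    stepMatrix G x t y z = if G.Adj y z ∧ stepSymb G x y z = t then 1 else 0 := rfl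

variable [Fintype V] [DecidableEq V]

theorem numWalks_eq_prod (x : V) (s : List Symb) (y z : V) :
    (numWalks G x s y z : ℂ) = (s.map (stepMatrix G x)).prod y z := by
  classical
  induction s generalizing y with
  | nil =>
    rw [List.map_nil, List.prod_nil, Matrix.one_apply, numWalks]
    split_ifs with h
    · subst h
      have : {p : G.Walk y y | shape G x p = []} = {SimpleGraph.Walk.nil} := by
        ext p
        cases p <;> simp [shape]
      simp [this]
    · have : {p : G.Walk y z | shape G x p = []} = ∅ := by
        ext p
        cases p
        · exact absurd rfl h
        · simp [shape]
      simp [this]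
  | cons t s ih =>
    have hfin := fun v : {v : V // G.Adj y v ∧ stepSymb G x y v = t} =>
      finite_walks_of_shape G x s v.1 z
    have h : numWalks G x (t :: s) y z =
        ∑ v : {v : V // G.Adj y v ∧ stepSymb G x y v = t}, numWalks G x s v z := by
      rw [numWalks, ← Nat.card_coe_set_eq]
      exact (Nat.card_congr (walksConsEquiv G x t s y z)).trans Nat.card_sigma
    rw [h, List.map_cons, List.prod_cons, Matrix.mul_apply, Nat.cast_sum]
    simp_rw [stepMatrix_apply, ite_mul, one_mul, zero_mul, ih]
    rw [← Finset.sum_filter]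
    exact (Finset.sum_subtype _ (fun v => Finset.mem_filter_univ v)
      (fun v => (s.map (stepMatrix G x)).prod v z)).symm

theorem numR_eq (x : V) (m : ℕ) (y z : V) :
    (numR G x m y z : ℂ) = (stepMatrix G x .r ^ m) y z := by
  simp [numR, numWalks_eq_prod]

theorem numRL_eq (x : V) (m : ℕ) (y z : V) :
    (numRL G x m y z : ℂ) = (stepMatrix G x .r ^ m * stepMatrix G x .l) y z := by
  simp [numRL, numWalks_eq_prod]

theorem numRF_eq (x : V) (m : ℕ) (y z : V) :
    (numRF G x m y z : ℂ) = (stepMatrix G x .r ^ m * stepMatrix G x .f) y z := by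
  simp [numRF, numWalks_eq_prod]

theorem numLR_eq (x : V) (m : ℕ) (y z : V) :
    (numLR G x m y z : ℂ) = (stepMatrix G x .l * stepMatrix G x .r ^ m) y z := by
  simp [numLR, numWalks_eq_prod]

end StepMatrices

/-! ### Steps and distances -/

section Steps

variable {V : Type*} {G : SimpleGraph V}

theorem stepSymb_eq_r {x u v : V} : stepSymb G x u v = .r ↔ G.dist x v = G.dist x u + 1 := by
  unfold stepSymb; split_ifs <;> simp_all

theorem stepSymb_eq_f {x u v : V} : stepSymb G x u v = .f ↔ G.dist x v = G.dist x u := by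
  unfold stepSymb; split_ifs <;> simp_all

/-- Adjacency is needed because `l` is the default value of `stepSymb`. -/
theorem stepSymb_eq_l {x u v : V} (h : G.Adj u v) :
    stepSymb G x u v = .l ↔ G.dist x v + 1 = G.dist x u := by
  have := h.diff_dist_adj (u := x)
  unfold stepSymb
  split_ifs
  · simp; omega
  · simp; omega
  · simp; omega

open Classical in
theorem stepMatrix_r_apply (x u v : V) :
    stepMatrix G x .r u v = if G.Adj u v ∧ G.dist x v = G.dist x u + 1 then 1 else 0 := by
  simp only [stepMatrix_apply, stepSymb_eq_r]

open Classical in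
theorem stepMatrix_f_apply (x u v : V) :
    stepMatrix G x .f u v = if G.Adj u v ∧ G.dist x v = G.dist x u then 1 else 0 := by
  simp only [stepMatrix_apply, stepSymb_eq_f]

open Classical in
theorem stepMatrix_l_apply (x u v : V) :
    stepMatrix G x .l u v = if G.Adj u v ∧ G.dist x v + 1 = G.dist x u then 1 else 0 := by
  simp only [stepMatrix_apply, and_congr_right stepSymb_eq_l]

theorem dist_cases_of_adj {u v : V} (h : G.Adj u v) (x : V) :
    G.dist x v + 1 = G.dist x u ∨ G.dist x v = G.dist x u ∨ G.dist x v = G.dist x u + 1 := by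
  have := h.diff_dist_adj (u := x)
  omega

theorem exists_adj_dist_succ (hG : G.Connected) {x z : V} {i : ℕ} (h : G.dist x z = i + 1) :
    ∃ v, G.Adj z v ∧ G.dist x v = i := by
  obtain ⟨p, hp⟩ := hG.exists_walk_length_eq_dist z x
  rw [SimpleGraph.dist_comm, h] at hp
  cases p with
  | nil => simp at hp
  | @cons _ v _ hv q =>
    refine ⟨v, hv, ?_⟩
    have h1 := SimpleGraph.dist_le q
    rw [SimpleGraph.Walk.length_cons] at hp
    rw [SimpleGraph.dist_comm] at h1
    have := dist_cases_of_adj hv x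
    omega

/-- A function that grows by at most one along every edge is bounded by the distance from any
of its zeros. -/
theorem le_dist_of_lipschitz (φ : V → ℕ) (hφ : ∀ u v, G.Adj u v → φ v ≤ φ u + 1) {u v : V}
    (hu : φ u = 0) (h : G.Reachable u v) : φ v ≤ G.dist u v := by
  have key : ∀ {a b : V} (p : G.Walk a b), φ b ≤ φ a + p.length := by
    intro a b p
    induction p with
    | nil => simp
    | cons hadj p ih =>
      have := hφ _ _ hadj
      rw [SimpleGraph.Walk.length_cons]
      omega
  obtain ⟨p, hp⟩ := h.exists_walk_length_eq_dist
  have := key p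
  omega

end Steps

/-! ### Distances in `H` -/

section GraphHDist

variable {X Y : Type*} {Γ : SimpleGraph X} {S : SimpleGraph Y} {x : X}

@[simp] theorem graphH_adj_some_some {p q : X × Y} :
    (graphH Γ S x).Adj (some p) (some q) ↔
      Γ.Adj p.1 q.1 ∧ p.2 = q.2 ∨ S.Adj p.2 q.2 ∧ p.1 = q.1 := SimpleGraph.boxProd_adj

@[simp] theorem graphH_adj_none_some {q : X × Y} :
    (graphH Γ S x).Adj none (some q) ↔ q.1 = x := Iff.rfl

@[simp] theorem graphH_adj_some_none {q : X × Y} :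
    (graphH Γ S x).Adj (some q) none ↔ q.1 = x := Iff.rfl

/-- The copy of `Γ` at the vertex `y` of `S`. -/
def copyHom (Γ : SimpleGraph X) (S : SimpleGraph Y) (x : X) (y : Y) : Γ →g graphH Γ S x where
  toFun z := some (z, y)
  map_rel' h := graphH_adj_some_some.2 (Or.inl ⟨h, rfl⟩)

theorem exists_walk_copy (hΓ : Γ.Connected) (S : SimpleGraph Y) (x a z : X) (y : Y) :
    ∃ p : (graphH Γ S x).Walk (some (a, y)) (some (z, y)), p.length = Γ.dist a z := by
  obtain ⟨p, hp⟩ := hΓ.exists_walk_length_eq_dist a z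
  exact ⟨p.map (copyHom Γ S x y), (SimpleGraph.Walk.length_map _ _).trans hp⟩

theorem exists_walk_none (hΓ : Γ.Connected) (S : SimpleGraph Y) (x z : X) (y : Y) :
    ∃ p : (graphH Γ S x).Walk none (some (z, y)), p.length = Γ.dist x z + 1 := by
  obtain ⟨p, hp⟩ := exists_walk_copy hΓ S x x z y
  exact ⟨.cons (graphH_adj_none_some.2 rfl) p, by simp [hp]⟩

theorem dist_none_some (hΓ : Γ.Connected) (S : SimpleGraph Y) (x : X) (p : X × Y) :
    (graphH Γ S x).dist none (some p) = Γ.dist x p.1 + 1 := by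
  obtain ⟨q, hq⟩ := exists_walk_none hΓ S x p.1 p.2
  refine le_antisymm (hq ▸ SimpleGraph.dist_le q) ?_
  -- Lower bound: the claimed distance, with value `0` at the new vertex, is itself a potential
  -- growing by at most one along edges.
  refine le_dist_of_lipschitz (G := graphH Γ S x)
    (fun o => o.elim 0 fun p => Γ.dist x p.1 + 1) ?_ rfl q.reachable
  rintro (_ | a) (_ | b) h
  · simp
  · rw [graphH_adj_none_some] at h
    simp [h]
  · simp
  · rcases graphH_adj_some_some.1 h with ⟨h, -⟩ | ⟨-, h⟩
    · have := dist_cases_of_adj h x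
      simp only [Option.elim_some]
      omega
    · simp [h]

theorem dist_some_some_same_le (hΓ : Γ.Connected) (S : SimpleGraph Y) (x z : X) (y : Y) :
    (graphH Γ S x).dist (some (x, y)) (some (z, y)) ≤ Γ.dist x z := by
  obtain ⟨q, hq⟩ := exists_walk_copy hΓ S x x z y
  exact hq ▸ SimpleGraph.dist_le q

theorem dist_some_some_of_adj (hΓ : Γ.Connected) {y y' : Y} (hy : S.Adj y y') (x z : X) :
    (graphH Γ S x).dist (some (x, y)) (some (z, y')) = Γ.dist x z + 1 := by
  classical
  obtain ⟨q, hq⟩ := exists_walk_copy hΓ S x x z y'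
  have hadj : (graphH Γ S x).Adj (some (x, y)) (some (x, y')) :=
    graphH_adj_some_some.2 (Or.inr ⟨hy, rfl⟩)
  refine le_antisymm ?_ ?_
  · rw [← hq, ← SimpleGraph.Walk.length_cons hadj]
    exact SimpleGraph.dist_le _
  -- The potential charges one extra unit for leaving copy `y`; the value `1` at the new vertex
  -- rules out a shortcut through it.
  · have := le_dist_of_lipschitz (G := graphH Γ S x)
      (fun o => o.elim 1 fun p => Γ.dist x p.1 + if p.2 = y then 0 else 1) ?_
      (u := some (x, y)) (by simp) (SimpleGraph.Walk.cons hadj q).reachable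
    · simpa [hy.ne'] using this
    rintro (_ | a) (_ | b) h
    · simp
    · rw [graphH_adj_none_some] at h
      simp only [h, Option.elim_some, Option.elim_none, SimpleGraph.dist_self]
      split_ifs <;> simp
    · simp
    · rcases graphH_adj_some_some.1 h with ⟨h, hab⟩ | ⟨-, h⟩
      · have := dist_cases_of_adj h x
        simp only [Option.elim_some, hab]
        omega
      · simp only [Option.elim_some, h]
        split_ifs <;> omega

end GraphHDist

/-! ### Regular weights and the local scalars of `Γ` -/

section PseudoDistanceRegular

variable {X : Type*} [Fintype X] {Γ : SimpleGraph X} {x : X}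

-- Clearing denominators makes the intersection numbers linear conditions on `ν`. A number is
-- nonzero as soon as one neighbour contributes, since all terms are positive.
open Classical in
theorem IsPseudoDistanceRegularAround.exists_weight (h : IsPseudoDistanceRegularAround Γ x) :
    ∃ ν : X → ℂ, (∀ u, ν u ≠ 0) ∧ ∃ c a b : ℕ → ℂ,
      (∀ u, (∑ v, if Γ.Adj u v ∧ Γ.dist x v + 1 = Γ.dist x u then ν v else 0) =
        c (Γ.dist x u) * ν u) ∧
      (∀ u, (∑ v, if Γ.Adj u v ∧ Γ.dist x v = Γ.dist x u then ν v else 0) =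
        a (Γ.dist x u) * ν u) ∧
      (∀ u, (∑ v, if Γ.Adj u v ∧ Γ.dist x v = Γ.dist x u + 1 then ν v else 0) =
        b (Γ.dist x u) * ν u) ∧
      (∀ u v, Γ.Adj u v → Γ.dist x v + 1 = Γ.dist x u → c (Γ.dist x u) ≠ 0) ∧
      (∀ u v, Γ.Adj u v → Γ.dist x v = Γ.dist x u + 1 → b (Γ.dist x u) ≠ 0) := by
  obtain ⟨ν, hν, -, c, a, b, h⟩ := h
  have key : ∀ (u : X) (P : X → Prop) [DecidablePred P] (k : ℝ), weightedDeg Γ ν u P = k →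
      (∑ v, if Γ.Adj u v ∧ P v then (ν v : ℂ) else 0) = k * ν u := by
    intro u P _ k hk
    rw [← hk, weightedDeg, ← Complex.ofReal_mul, Finset.sum_mul, ← Finset.sum_filter,
      Complex.ofReal_sum]
    refine Finset.sum_congr (by ext; simp) fun v _ => by rw [div_mul_cancel₀ _ (hν u).ne']
  have pos : ∀ (u v : X) (P : X → Prop) (k : ℝ), weightedDeg Γ ν u P = k → Γ.Adj u v → P v →
      (k : ℂ) ≠ 0 := by
    intro u v P k hk huv hv
    rw [Complex.ofReal_ne_zero, ← hk]
    refine (Finset.sum_pos (fun w _ => div_pos (hν w) (hν u)) ⟨v, ?_⟩).ne'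
    simp [huv, hv]
  exact ⟨fun u => ν u, fun u => Complex.ofReal_ne_zero.2 (hν u).ne', fun i => c i, fun i => a i,
    fun i => b i, fun u => key u _ _ (h u).1, fun u => key u _ _ (h u).2.1,
    fun u => key u _ _ (h u).2.2, fun u v => pos u v _ _ (h u).1, fun u v => pos u v _ _ (h u).2.2⟩

theorem exists_localScalars [DecidableEq X] (hΓ : Γ.Connected)
    (h : IsPseudoDistanceRegularAround Γ x) : ∃ α β : ℕ → ℂ, LocalScalars Γ x α β := by
  classical
  obtain ⟨ν, hν, c, a, b, hc, ha, hb, -, -⟩ := h.exists_weight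
  -- `g i` is the ratio `r^i(z) / ν z` on the `i`-th sphere: summing over the last step multiplies
  -- it by `c (i + 1)`.
  obtain ⟨g, hg0, hg⟩ : ∃ g : ℕ → ℂ, g 0 * ν x = 1 ∧ ∀ i, g (i + 1) = g i * c (i + 1) :=
    ⟨fun i => Nat.rec (ν x)⁻¹ (fun i gi => gi * c (i + 1)) i, inv_mul_cancel₀ (hν x),
      fun _ => rfl⟩
  have hpow : ∀ (i : ℕ) (z : X),
      (stepMatrix Γ x .r ^ i) x z = if Γ.dist x z = i then g i * ν z else 0 := by
    intro i
    induction i with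
    | zero =>
      intro z
      simp only [pow_zero, Matrix.one_apply, hΓ.dist_eq_zero_iff]
      split_ifs with h
      · rw [← h, hg0]
      · rfl
    | succ i ih =>
      intro z
      rw [pow_succ, Matrix.mul_apply]
      split_ifs with hz
      · rw [hg, ← hz, mul_assoc, ← hc, Finset.mul_sum]
        refine Finset.sum_congr rfl fun v _ => ?_
        rw [ih, stepMatrix_r_apply, hz, Γ.adj_comm]
        by_cases hv : Γ.dist x v = i <;> simp [hv]
      · refine Finset.sum_eq_zero fun v _ => ?_
        rw [ih, stepMatrix_r_apply]
        by_cases hv : Γ.dist x v = i <;> simp [hv, hz]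
  -- A final `ℓ` step into `z` comes from the next sphere, giving `g (i + 1) * b i * ν z`; a final
  -- `f` step gives `g i * a i * ν z`.
  refine ⟨fun i => c (i + 1) * b i, a, fun i _ z hz => ⟨?_, ?_⟩⟩
  · rw [numRL_eq, numR_eq, Matrix.mul_apply, hpow, if_pos hz]
    have hb := hb z
    rw [hz] at hb
    rw [mul_assoc, mul_left_comm (b i), ← hb, mul_left_comm, ← mul_assoc, ← hg, Finset.mul_sum]
    refine Finset.sum_congr rfl fun v _ => ?_
    rw [hpow, stepMatrix_l_apply, hz, Γ.adj_comm]
    by_cases hv : Γ.dist x v = i + 1 <;> simp [hv]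
  · rw [numRF_eq, numR_eq, Matrix.mul_apply, hpow, if_pos hz]
    have ha := ha z
    rw [hz] at ha
    rw [mul_left_comm, ← ha, Finset.mul_sum]
    refine Finset.sum_congr rfl fun v _ => ?_
    rw [hpow, stepMatrix_f_apply, hz, Γ.adj_comm]
    by_cases hv : Γ.dist x v = i <;> simp [hv]

end PseudoDistanceRegular
end TerwAlg

namespace TerwAlg

/-! ### Walk counts in `H` and the combinatorial conditions -/

section CombConditions

variable {X Y : Type*} {Γ : SimpleGraph X} {S : SimpleGraph Y} {x : X}

theorem stepMatrix_graphH_r [DecidableEq Y] (hΓ : Γ.Connected) (a z : X) (y y' : Y) :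
    stepMatrix (graphH Γ S x) none .r (some (a, y)) (some (z, y')) =
      if y = y' then stepMatrix Γ x .r a z else 0 := by
  classical
  simp only [stepMatrix_r_apply, dist_none_some hΓ, graphH_adj_some_some, add_left_inj]
  by_cases hy : y = y'
  · simp [hy]
  · by_cases ha : a = z <;> simp [hy, ha]

theorem stepMatrix_graphH_l [DecidableEq Y] (hΓ : Γ.Connected) (a z : X) (y y' : Y) :
    stepMatrix (graphH Γ S x) none .l (some (a, y)) (some (z, y')) =
      if y = y' then stepMatrix Γ x .l a z else 0 := by
  classical
  simp only [stepMatrix_l_apply, dist_none_some hΓ, graphH_adj_some_some, add_left_inj]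
  by_cases hy : y = y'
  · simp [hy]
  · by_cases ha : a = z <;> simp [hy, ha]

open Classical in
theorem stepMatrix_graphH_f (hΓ : Γ.Connected) (a z : X) (y y' : Y) :
    stepMatrix (graphH Γ S x) none .f (some (a, y)) (some (z, y')) =
      (if y = y' then stepMatrix Γ x .f a z else 0) + if S.Adj y y' ∧ a = z then 1 else 0 := by
  simp only [stepMatrix_f_apply, dist_none_some hΓ, graphH_adj_some_some, add_left_inj]
  by_cases hy : y = y'
  · simp [hy]
  · by_cases ha : a = z <;> simp [hy, ha]

theorem stepMatrix_graphH_r_some_none (p : X × Y) :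
    stepMatrix (graphH Γ S x) none .r (some p) none = 0 := by
  simp [stepMatrix_r_apply]

theorem stepMatrix_graphH_r_none_none :
    stepMatrix (graphH Γ S x) none .r none none = 0 := by
  simp [stepMatrix_r_apply]

theorem stepMatrix_graphH_r_none_some [DecidableEq X] (hΓ : Γ.Connected) (p : X × Y) :
    stepMatrix (graphH Γ S x) none .r none (some p) = if p.1 = x then 1 else 0 := by
  rw [stepMatrix_r_apply, dist_none_some hΓ, graphH_adj_none_some]
  by_cases h : p.1 = x <;> simp [h]

theorem stepMatrix_graphH_l_some_none (hΓ : Γ.Connected) (y : Y) :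
    stepMatrix (graphH Γ S x) none .l (some (x, y)) none = 1 := by
  simp [stepMatrix_l_apply, dist_none_some hΓ]

theorem stepMatrix_l_base (a : X) : stepMatrix Γ x .l x a = 0 := by
  simp [stepMatrix_l_apply]

variable [Fintype X] [DecidableEq X] [Fintype Y] [DecidableEq Y]

theorem stepMatrix_graphH_r_pow_some_none (m : ℕ) (p : X × Y) :
    (stepMatrix (graphH Γ S x) none .r ^ m) (some p) none = 0 := by
  cases m with
  | zero => simp
  | succ m =>
    rw [pow_succ, Matrix.mul_apply, Fintype.sum_option]
    simp [stepMatrix_graphH_r_some_none, stepMatrix_graphH_r_none_none]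

theorem stepMatrix_graphH_r_pow (hΓ : Γ.Connected) (m : ℕ) (a z : X) (y y' : Y) :
    (stepMatrix (graphH Γ S x) none .r ^ m) (some (a, y)) (some (z, y')) =
      if y = y' then (stepMatrix Γ x .r ^ m) a z else 0 := by
  induction m generalizing z y' with
  | zero => by_cases hy : y = y' <;> simp [Matrix.one_apply, hy]
  | succ m ih =>
    rw [pow_succ, Matrix.mul_apply, Fintype.sum_option, stepMatrix_graphH_r_pow_some_none,
      zero_mul, zero_add, Fintype.sum_prod_type, pow_succ, Matrix.mul_apply]
    simp [ih, stepMatrix_graphH_r hΓ]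

theorem numR_graphH (hΓ : Γ.Connected) (m : ℕ) (z : X) (y y' : Y) :
    (numR (graphH Γ S x) none m (some (x, y)) (some (z, y')) : ℂ) =
      if y = y' then (numR Γ x m x z : ℂ) else 0 := by
  rw [numR_eq, numR_eq, stepMatrix_graphH_r_pow hΓ]

theorem numRL_graphH (hΓ : Γ.Connected) (m : ℕ) (z : X) (y y' : Y) :
    (numRL (graphH Γ S x) none m (some (x, y)) (some (z, y')) : ℂ) =
      if y = y' then (numRL Γ x m x z : ℂ) else 0 := by
  rw [numRL_eq, numRL_eq, Matrix.mul_apply, Fintype.sum_option,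
    stepMatrix_graphH_r_pow_some_none, zero_mul, zero_add, Fintype.sum_prod_type,
    Matrix.mul_apply]
  simp [stepMatrix_graphH_r_pow hΓ, stepMatrix_graphH_l hΓ]

-- The final flat step either stays in the copy of `Γ`, or fixes `z` and changes the copy.
open Classical in
theorem numRF_graphH (hΓ : Γ.Connected) (m : ℕ) (z : X) (y y' : Y) :
    (numRF (graphH Γ S x) none m (some (x, y)) (some (z, y')) : ℂ) =
      (if y = y' then (numRF Γ x m x z : ℂ) else 0) +
        if S.Adj y y' then (numR Γ x m x z : ℂ) else 0 := by
  rw [numRF_eq, numRF_eq, numR_eq, Matrix.mul_apply, Fintype.sum_option,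
    stepMatrix_graphH_r_pow_some_none, zero_mul, zero_add, Fintype.sum_prod_type,
    Matrix.mul_apply]
  simp [stepMatrix_graphH_r_pow hΓ, stepMatrix_graphH_f hΓ, mul_add, Finset.sum_add_distrib,
    ite_and]
  rw [Finset.sum_eq_single z (by simp +contextual) (by simp),
    Finset.sum_eq_single y (by simp +contextual [eq_comm]) (by simp)]
  simp

/-- The `ℓ` step must lead to the new vertex and the first `r` step must enter copy `y'`, whence the
count is independent of `y` and `y'`. -/
theorem numLR_graphH (hΓ : Γ.Connected) (m : ℕ) (z : X) (y y' : Y) :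
    (numLR (graphH Γ S x) none (m + 1) (some (x, y)) (some (z, y')) : ℂ) = numR Γ x m x z := by
  rw [numLR_eq, numR_eq, Matrix.mul_apply, Fintype.sum_option, stepMatrix_graphH_l_some_none hΓ,
    one_mul]
  simp only [stepMatrix_graphH_l hΓ, stepMatrix_l_base, ite_self, zero_mul,
    Finset.sum_const_zero, add_zero]
  rw [pow_succ', Matrix.mul_apply, Fintype.sum_option, stepMatrix_graphH_r_none_none, zero_mul,
    zero_add, Fintype.sum_prod_type_right]
  simp [stepMatrix_graphH_r_none_some hΓ, stepMatrix_graphH_r_pow hΓ]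

theorem combConditions_graphH (hΓ : Γ.Connected) (hS : ∀ y y', S.Adj y y' ↔ y ≠ y')
    {α β : ℕ → ℂ} (h : LocalScalars Γ x α β) :
    CombConditions (graphH Γ S x) none (fun i => α (i - 1)) (fun _ => 0)
      (fun i => β (i - 1) - 1) (fun _ => 1) := by
  classical
  -- From here the index in `H` is `i + 1`, so `i` is the distance in `Γ`.
  rintro (_ | i) hi -
  · omega
  have hlocal : ∀ z, Γ.dist x z = i → (numRL Γ x (i + 1) x z : ℂ) = α i * numR Γ x i x z ∧
      (numRF Γ x i x z : ℂ) = β i * numR Γ x i x z := by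
    intro z hz
    refine h i ?_ z hz
    rw [← hz, (hΓ x z).coe_dist_eq_edist]
    exact SimpleGraph.edist_le_eccent
  -- The second part recognises the copy from the distance; the first leaves `D^i_{i+1}` empty.
  have hdist : ∀ (z : X) (y y' : Y),
      (graphH Γ S x).dist (some (x, y)) (some (z, y')) ≤ Γ.dist x z + 1 ∧
      (y = y' ↔ (graphH Γ S x).dist (some (x, y)) (some (z, y')) ≤ Γ.dist x z) := by
    intro z y y'
    by_cases hy : y = y'
    · subst hy
      have := dist_some_some_same_le hΓ S x z y
      exact ⟨by omega, by simpa using this⟩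
    · have := dist_some_some_of_adj hΓ ((hS y y').2 hy) x z
      exact ⟨by omega, by simp [hy, this]⟩
  refine ⟨?_, ?_⟩
  · rintro (_ | ⟨a, y⟩) hy
    · exact absurd hy (SimpleGraph.irrefl _)
    obtain rfl : a = x := hy
    refine ⟨?_, ?_⟩
    · rintro (_ | ⟨z, y'⟩) hz
      · simp [distSet] at hz
      have hd := hdist z y y'
      simp only [distSet, Set.mem_union, Set.mem_ofPred_eq, dist_none_some hΓ] at hz
      have hne : y ≠ y' := fun h => by have := hd.2.1 h; omega
      simp [numRL_graphH hΓ, numRF_graphH hΓ, numLR_graphH hΓ, hne, hS]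
    · rintro (_ | ⟨z, y'⟩) hz
      · simp [distSet] at hz
      have hd := hdist z y y'
      simp only [distSet, Set.mem_ofPred_eq, dist_none_some hΓ] at hz
      obtain rfl : y = y' := hd.2.2 (by omega)
      have := hlocal z (by omega)
      simp [numRL_graphH hΓ, numRF_graphH hΓ, numLR_graphH hΓ, numR_graphH hΓ, this]
      ring
  · rintro ⟨_ | ⟨a, y⟩, hy, _ | ⟨z, y'⟩, hz⟩
    · exact absurd hy (SimpleGraph.irrefl _)
    · exact absurd hy (SimpleGraph.irrefl _)
    · simp [distSet] at hz
    · obtain rfl : a = x := hy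
      have hd := hdist z y y'
      simp only [distSet, Set.mem_ofPred_eq, dist_none_some hΓ] at hz
      omega

end CombConditions
end TerwAlg

namespace TerwAlg

/-! ### Tensor vectors and the action of `T` -/

section Modules

variable {X Y : Type*} {Γ : SimpleGraph X} {S : SimpleGraph Y} {x : X}

/-- The map `f ↦ f ⊗ s` into the standard module of `H(Γ, S)`; the new vertex gets the value `0`. -/
def tensorMap (X : Type*) {Y : Type*} (s : Y → ℂ) : (X → ℂ) →ₗ[ℂ] (Option (X × Y) → ℂ) where
  toFun f o := o.elim 0 fun p => f p.1 * s p.2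
  map_add' f g := by ext (_ | p) <;> simp [add_mul]
  map_smul' c f := by ext (_ | p) <;> simp [mul_assoc]

@[simp] theorem tensorMap_none (s : Y → ℂ) (f : X → ℂ) : tensorMap X s f none = 0 := rfl

@[simp] theorem tensorMap_some (s : Y → ℂ) (f : X → ℂ) (p : X × Y) :
    tensorMap X s f (some p) = f p.1 * s p.2 := rfl

theorem tensorMap_injective {s : Y → ℂ} (hs : s ≠ 0) :
    Function.Injective (tensorMap X s) := by
  obtain ⟨y, hy⟩ := Function.ne_iff.1 hs
  intro f g h
  ext z
  exact mul_right_cancel₀ hy (congrFun h (some (z, y)))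

/-- The functions on the vertices whose quotient by `ν` depends only on the distance to `x`. -/
def radial (Γ : SimpleGraph X) (x : X) (ν : X → ℂ) : Submodule ℂ (X → ℂ) where
  carrier := {f | ∃ g : ℕ → ℂ, ∀ z, f z = g (Γ.dist x z) * ν z}
  zero_mem' := ⟨0, by simp⟩
  add_mem' := by
    rintro f f' ⟨g, hg⟩ ⟨g', hg'⟩
    exact ⟨g + g', fun z => by simp [hg, hg', add_mul]⟩
  smul_mem' := by
    rintro c f ⟨g, hg⟩
    exact ⟨c • g, fun z => by simp [hg, mul_assoc]⟩

/-- The restriction of `ν` to the vertices at distance `i` from `x`. -/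
noncomputable def sphereVec (Γ : SimpleGraph X) (x : X) (ν : X → ℂ) (i : ℕ) : X → ℂ :=
  fun z => if Γ.dist x z = i then ν z else 0

/-- The submodule of the vectors `f ⊗ s` with `f` radial. -/
noncomputable def radialModule (Γ : SimpleGraph X) (x : X) (ν : X → ℂ) (s : Y → ℂ) :
    Submodule ℂ (Option (X × Y) → ℂ) :=
  (radial Γ x ν).map (tensorMap X s)

theorem sphereVec_mem_radial (ν : X → ℂ) (i : ℕ) : sphereVec Γ x ν i ∈ radial Γ x ν :=
  ⟨fun j => if j = i then 1 else 0, fun z => by simp [sphereVec]⟩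

variable [Fintype X] [DecidableEq X] [Fintype Y] [DecidableEq Y]

theorem dualIdem_mulVec (i : ℕ) (f : X → ℂ) (z : X) :
    (dualIdem Γ x i *ᵥ f) z = if Γ.dist x z = i then f z else 0 := by
  simp [dualIdem, Matrix.mulVec_diagonal]

theorem dualIdem_tensorMap_zero (hΓ : Γ.Connected) (s : Y → ℂ) (f : X → ℂ) :
    dualIdem (graphH Γ S x) none 0 *ᵥ tensorMap X s f = 0 := by
  ext (_ | p)
  · simp [dualIdem_mulVec]
  · simp [dualIdem_mulVec, dist_none_some hΓ]

theorem dualIdem_tensorMap_succ (hΓ : Γ.Connected) (s : Y → ℂ) (f : X → ℂ) (i : ℕ) :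
    dualIdem (graphH Γ S x) none (i + 1) *ᵥ tensorMap X s f =
      tensorMap X s (dualIdem Γ x i *ᵥ f) := by
  ext (_ | p)
  · simp [dualIdem_mulVec]
  · simp [dualIdem_mulVec, dist_none_some hΓ]

open Classical in
theorem adjM_mulVec {V : Type*} [Fintype V] [DecidableEq V] (G : SimpleGraph V) (f : V → ℂ)
    (u : V) : (adjM G *ᵥ f) u = ∑ v, if G.Adj u v then f v else 0 := by
  simp [adjM, Matrix.mulVec, dotProduct, SimpleGraph.adjMatrix_apply]

/-- The old vertices carry `A_Γ ⊗ I + I ⊗ (J - I)`, and `J` kills `s`. -/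
theorem adjM_tensorMap (hS : ∀ y y', S.Adj y y' ↔ y ≠ y') {s : Y → ℂ} (hs : ∑ y, s y = 0)
    (f : X → ℂ) :
    adjM (graphH Γ S x) *ᵥ tensorMap X s f = tensorMap X s (adjM Γ *ᵥ f - f) := by
  classical
  ext (_ | ⟨z, y⟩)
  · rw [adjM_mulVec, Fintype.sum_option, Fintype.sum_prod_type_right]
    simp [← Finset.mul_sum, hs]
  · rw [adjM_mulVec, Fintype.sum_option, Fintype.sum_prod_type]
    -- The edges of `K_n` are written as all pairs minus the diagonal, so that the full sum over
    -- `y'` vanishes by `hs`.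
    have h : ∀ z' y', (if (graphH Γ S x).Adj (some (z, y)) (some (z', y')) then
        tensorMap X s f (some (z', y')) else 0) =
        (if y = y' then (if Γ.Adj z z' then f z' else 0) * s y' else 0) +
          ((if z = z' then f z' * s y' else 0) -
            if y = y' then (if z = z' then f z' * s y' else 0) else 0) := by
      intro z' y'
      rw [graphH_adj_some_some]
      by_cases hy : y = y' <;> by_cases hz : z = z' <;> by_cases ha : Γ.Adj z z' <;>
        simp_all
    simp only [h, Finset.sum_add_distrib, Finset.sum_sub_distrib]
    rw [Finset.sum_comm (f := fun z' y' => if z = z' then f z' * s y' else 0)]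
    simp [← Finset.mul_sum, hs, adjM_mulVec, sub_eq_add_neg, add_mul]
    simp [Finset.sum_mul]

theorem dualIdem_mem (G : SimpleGraph X) (x : X) (i : ℕ) : dualIdem G x i ∈ terwilliger G x :=
  Algebra.subset_adjoin (Or.inr ⟨i, rfl⟩)

theorem adjM_mem (G : SimpleGraph X) (x : X) : adjM G ∈ terwilliger G x :=
  Algebra.subset_adjoin (Or.inl rfl)

/-- One matrix `b` serves every `s` at once; this uniformity later gives the isomorphisms. Only the
generators need checking. -/
theorem exists_matrix_of_mem_terwilliger (hΓ : Γ.Connected)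
    (hS : ∀ y y', S.Adj y y' ↔ y ≠ y') (N : Submodule ℂ (X → ℂ))
    (hA : ∀ f ∈ N, adjM Γ *ᵥ f ∈ N) (hE : ∀ i, ∀ f ∈ N, dualIdem Γ x i *ᵥ f ∈ N)
    {B : Matrix (Option (X × Y)) (Option (X × Y)) ℂ}
    (hB : B ∈ terwilliger (graphH Γ S x) none) :
    ∃ b : Matrix X X ℂ, (∀ f ∈ N, b *ᵥ f ∈ N) ∧
      ∀ s : Y → ℂ, ∑ y, s y = 0 → ∀ f, B *ᵥ tensorMap X s f = tensorMap X s (b *ᵥ f) := by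
  induction hB using Algebra.adjoin_induction with
  | mem B hB =>
    rcases hB with rfl | ⟨_ | i, rfl⟩
    · refine ⟨adjM Γ - 1, fun f hf => ?_, fun s hs f => ?_⟩
      · rw [Matrix.sub_mulVec, Matrix.one_mulVec]
        exact N.sub_mem (hA f hf) hf
      · rw [Matrix.sub_mulVec, Matrix.one_mulVec, adjM_tensorMap hS hs]
    · exact ⟨0, fun f _ => by simp, fun s _ f => by simp [dualIdem_tensorMap_zero hΓ]⟩
    · exact ⟨dualIdem Γ x i, hE i, fun s _ f => dualIdem_tensorMap_succ hΓ s f i⟩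
  | algebraMap r =>
    refine ⟨algebraMap ℂ _ r, fun f hf => ?_, fun s _ f => ?_⟩
    · rw [Algebra.algebraMap_eq_smul_one, Matrix.smul_mulVec, Matrix.one_mulVec]
      exact N.smul_mem r hf
    · simp [Algebra.algebraMap_eq_smul_one, Matrix.smul_mulVec]
  | add B C _ _ hB hC =>
    obtain ⟨b, hb, hB⟩ := hB
    obtain ⟨c, hc, hC⟩ := hC
    refine ⟨b + c, fun f hf => ?_, fun s hs f => ?_⟩
    · rw [Matrix.add_mulVec]
      exact N.add_mem (hb f hf) (hc f hf)
    · rw [Matrix.add_mulVec, Matrix.add_mulVec, map_add, hB s hs, hC s hs]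
  | mul B C _ _ hB hC =>
    obtain ⟨b, hb, hB⟩ := hB
    obtain ⟨c, hc, hC⟩ := hC
    refine ⟨b * c, fun f hf => ?_, fun s hs f => ?_⟩
    · rw [← Matrix.mulVec_mulVec]
      exact hb _ (hc f hf)
    · rw [← Matrix.mulVec_mulVec, ← Matrix.mulVec_mulVec, hC s hs, hB s hs]

theorem dualIdem_mem_radial {ν f : X → ℂ} (hf : f ∈ radial Γ x ν) (i : ℕ) :
    dualIdem Γ x i *ᵥ f ∈ radial Γ x ν := by
  obtain ⟨g, hg⟩ := hf
  refine ⟨fun j => if j = i then g j else 0, fun z => ?_⟩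
  rw [dualIdem_mulVec]
  split_ifs with h <;> simp [hg, h]

theorem dualIdem_mulVec_radial {ν f : X → ℂ} {g : ℕ → ℂ}
    (hg : ∀ z, f z = g (Γ.dist x z) * ν z) (i : ℕ) :
    dualIdem Γ x i *ᵥ f = g i • sphereVec Γ x ν i := by
  ext z
  rw [dualIdem_mulVec, Pi.smul_apply, sphereVec]
  split_ifs with h
  · rw [hg, h, smul_eq_mul]
  · simp

/-- A step between consecutive spheres, inside an arbitrary `T`-module. -/
theorem tensorMap_mem_of_adjM {ν : X → ℂ} (hΓ : Γ.Connected) (hS : ∀ y y', S.Adj y y' ↔ y ≠ y')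
    {s : Y → ℂ} (hs : ∑ y, s y = 0) {U : Submodule ℂ (Option (X × Y) → ℂ)}
    (hU : IsTModule (graphH Γ S x) none U) {i j : ℕ} (hij : i ≠ j)
    (h : tensorMap X s (sphereVec Γ x ν i) ∈ U) {k : ℂ} (hk : k ≠ 0)
    (hE : dualIdem Γ x j *ᵥ (adjM Γ *ᵥ sphereVec Γ x ν i) = k • sphereVec Γ x ν j) :
    tensorMap X s (sphereVec Γ x ν j) ∈ U := by
  have h1 := hU _ (dualIdem_mem _ _ (j + 1)) _ (hU _ (adjM_mem _ _) _ h)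
  -- This removes the `-1` in the action `A_Γ - 1`.
  have h2 : dualIdem Γ x j *ᵥ sphereVec Γ x ν i = 0 := by
    ext z
    rw [dualIdem_mulVec, sphereVec]
    split_ifs with h1 h2
    · omega
    all_goals rfl
  rw [adjM_tensorMap hS hs, dualIdem_tensorMap_succ hΓ, Matrix.mulVec_sub, hE, h2, sub_zero,
    map_smul] at h1
  exact (U.smul_mem_iff hk).1 h1

theorem isThin_radialModule {ν : X → ℂ} (hΓ : Γ.Connected) (s : Y → ℂ) :
    IsThin (graphH Γ S x) none (radialModule Γ x ν s) := by
  have key : ∀ i, ∃ v, subcons (graphH Γ S x) none (radialModule Γ x ν s) i ≤ ℂ ∙ v := by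
    rintro (_ | i)
    · refine ⟨0, ?_⟩
      rintro _ ⟨_, ⟨f, -, rfl⟩, rfl⟩
      rw [Matrix.mulVecLin_apply, dualIdem_tensorMap_zero hΓ]
      exact zero_mem _
    · refine ⟨tensorMap X s (sphereVec Γ x ν i), ?_⟩
      rintro _ ⟨_, ⟨f, ⟨g, hg⟩, rfl⟩, rfl⟩
      rw [Matrix.mulVecLin_apply, dualIdem_tensorMap_succ hΓ, dualIdem_mulVec_radial hg, map_smul]
      exact Submodule.smul_mem _ _ (Submodule.mem_span_singleton_self _)
  intro i
  obtain ⟨v, hv⟩ := key i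
  refine (Submodule.finrank_mono hv).trans ((finrank_span_le_card _).trans ?_)
  simp

open Classical in
/-- A nowhere zero weight `ν` for which the weighted numbers of neighbours in the preceding, same
and following sphere around `x` are functions `c`, `a`, `b` of the distance to `x`. -/
structure IsRegularWeight (Γ : SimpleGraph X) (x : X) (ν : X → ℂ) (c a b : ℕ → ℂ) : Prop where
  ne_zero : ∀ u, ν u ≠ 0
  sum_c : ∀ u, (∑ v, if Γ.Adj u v ∧ Γ.dist x v + 1 = Γ.dist x u then ν v else 0) =
        c (Γ.dist x u) * ν u
  sum_a : ∀ u, (∑ v, if Γ.Adj u v ∧ Γ.dist x v = Γ.dist x u then ν v else 0) =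
        a (Γ.dist x u) * ν u
  sum_b : ∀ u, (∑ v, if Γ.Adj u v ∧ Γ.dist x v = Γ.dist x u + 1 then ν v else 0) =
        b (Γ.dist x u) * ν u
  c_ne_zero : ∀ u v, Γ.Adj u v → Γ.dist x v + 1 = Γ.dist x u → c (Γ.dist x u) ≠ 0
  b_ne_zero : ∀ u v, Γ.Adj u v → Γ.dist x v = Γ.dist x u + 1 → b (Γ.dist x u) ≠ 0

/-! ### The irreducible modules with endpoint 1 -/

namespace IsRegularWeight

variable {ν : X → ℂ} {c a b : ℕ → ℂ}

theorem adjM_mem_radial (hν : IsRegularWeight Γ x ν c a b) {f : X → ℂ}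
    (hf : f ∈ radial Γ x ν) : adjM Γ *ᵥ f ∈ radial Γ x ν := by
  classical
  obtain ⟨g, hg⟩ := hf
  -- The truncated `i - 1` at `i = 0` is harmless: the sum defining `c 0` is empty.
  refine ⟨fun i => g (i - 1) * c i + g i * a i + g (i + 1) * b i, fun u => ?_⟩
  simp only [add_mul, mul_assoc]
  rw [adjM_mulVec, ← hν.sum_c, ← hν.sum_a, ← hν.sum_b, Finset.mul_sum, Finset.mul_sum,
    Finset.mul_sum, ← Finset.sum_add_distrib, ← Finset.sum_add_distrib]
  refine Finset.sum_congr rfl fun v _ => ?_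
  by_cases h : Γ.Adj u v
  · rcases dist_cases_of_adj h x with hd | hd | hd
    · simp [h, hg, ← hd, add_assoc]
    · simp [h, hg, hd]
    · simp [h, hg, hd, add_assoc]
  · simp [h]

theorem dualIdem_adjM_sphereVec_up (hν : IsRegularWeight Γ x ν c a b) (i : ℕ) :
    dualIdem Γ x (i + 1) *ᵥ (adjM Γ *ᵥ sphereVec Γ x ν i) =
      c (i + 1) • sphereVec Γ x ν (i + 1) := by
  classical
  ext u
  rw [dualIdem_mulVec, Pi.smul_apply, sphereVec, smul_eq_mul]
  split_ifs with h
  · rw [← h, ← hν.sum_c, adjM_mulVec]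
    refine Finset.sum_congr rfl fun v _ => ?_
    simp [sphereVec, h, ite_and]
  · simp

theorem dualIdem_adjM_sphereVec_down (hν : IsRegularWeight Γ x ν c a b) (i : ℕ) :
    dualIdem Γ x i *ᵥ (adjM Γ *ᵥ sphereVec Γ x ν (i + 1)) = b i • sphereVec Γ x ν i := by
  classical
  ext u
  rw [dualIdem_mulVec, Pi.smul_apply, sphereVec, smul_eq_mul]
  split_ifs with h
  · rw [← h, ← hν.sum_b, adjM_mulVec]
    refine Finset.sum_congr rfl fun v _ => ?_
    simp [sphereVec, ite_and]
  · simp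

theorem isTModule_radialModule (hν : IsRegularWeight Γ x ν c a b) (hΓ : Γ.Connected)
    (hS : ∀ y y', S.Adj y y' ↔ y ≠ y')
    {s : Y → ℂ} (hs : ∑ y, s y = 0) :
    IsTModule (graphH Γ S x) none (radialModule Γ x ν s) := by
  rintro B hB _ ⟨f, hf, rfl⟩
  obtain ⟨β, hβ, hB⟩ := exists_matrix_of_mem_terwilliger hΓ hS (radial Γ x ν)
    (fun _ => hν.adjM_mem_radial) (fun i _ hf => dualIdem_mem_radial hf i) hB
  exact ⟨β *ᵥ f, hβ f hf, (hB s hs f).symm⟩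

/-- Climbing from sphere to sphere is possible since `c (i + 1) ≠ 0` while the next sphere is
nonempty; beyond the eccentricity the sphere vectors are zero. -/
theorem radialModule_le (hν : IsRegularWeight Γ x ν c a b) (hΓ : Γ.Connected)
    (hS : ∀ y y', S.Adj y y' ↔ y ≠ y')
    {s : Y → ℂ} (hs : ∑ y, s y = 0) {U : Submodule ℂ (Option (X × Y) → ℂ)}
    (hU : IsTModule (graphH Γ S x) none U)
    (h0 : tensorMap X s (sphereVec Γ x ν 0) ∈ U) : radialModule Γ x ν s ≤ U := by
  classical
  have hall : ∀ i, tensorMap X s (sphereVec Γ x ν i) ∈ U := by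
    intro i
    induction i with
    | zero => exact h0
    | succ i ih =>
      by_cases h : ∃ z, Γ.dist x z = i + 1
      · obtain ⟨z, hz⟩ := h
        obtain ⟨v, hzv, hv⟩ := exists_adj_dist_succ hΓ hz
        have hc := hν.c_ne_zero z v hzv (by omega)
        rw [hz] at hc
        exact tensorMap_mem_of_adjM hΓ hS hs hU (by omega) ih hc
          (hν.dualIdem_adjM_sphereVec_up i)
      · have : sphereVec Γ x ν (i + 1) = 0 := by
          ext z
          exact if_neg fun hz => h ⟨z, hz⟩
        simp [this]
  rintro _ ⟨f, ⟨g, hg⟩, rfl⟩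
  have : f = ∑ i ∈ Finset.univ.image (Γ.dist x), g i • sphereVec Γ x ν i := by
    ext z
    simp [sphereVec, hg]
  rw [this, map_sum]
  exact U.sum_mem fun i _ => by rw [map_smul]; exact U.smul_mem _ (hall i)

/-- Descends along a geodesic from `z` to `x`, whose vertices witness that each `b` used is nonzero.
-/
theorem sphereVec_zero_mem (hν : IsRegularWeight Γ x ν c a b) (hΓ : Γ.Connected)
    (hS : ∀ y y', S.Adj y y' ↔ y ≠ y')
    {s : Y → ℂ} (hs : ∑ y, s y = 0) {U : Submodule ℂ (Option (X × Y) → ℂ)}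
    (hU : IsTModule (graphH Γ S x) none U) (i : ℕ) (z : X) (hz : Γ.dist x z = i)
    (h : tensorMap X s (sphereVec Γ x ν i) ∈ U) : tensorMap X s (sphereVec Γ x ν 0) ∈ U := by
  induction i generalizing z with
  | zero => exact h
  | succ i ih =>
    obtain ⟨v, hzv, hv⟩ := exists_adj_dist_succ hΓ hz
    refine ih v hv ?_
    have hb := hν.b_ne_zero v z hzv.symm (by omega)
    rw [hv] at hb
    exact tensorMap_mem_of_adjM hΓ hS hs hU (by omega) h hb
      (hν.dualIdem_adjM_sphereVec_down i)

theorem sphereVec_zero_ne_zero (hν : IsRegularWeight Γ x ν c a b) :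
    sphereVec Γ x ν 0 ≠ 0 := fun h => by
  have := congrFun h x
  simp [sphereVec, hν.ne_zero] at this

theorem isIrredTModule_radialModule (hν : IsRegularWeight Γ x ν c a b) (hΓ : Γ.Connected)
    (hS : ∀ y y', S.Adj y y' ↔ y ≠ y')
    {s : Y → ℂ} (hs : ∑ y, s y = 0) (hs0 : s ≠ 0) :
    IsIrredTModule (graphH Γ S x) none (radialModule Γ x ν s) := by
  refine ⟨hν.isTModule_radialModule hΓ hS hs, fun h => ?_, fun U hU hle => ?_⟩
  · have : tensorMap X s (sphereVec Γ x ν 0) ∈ radialModule Γ x ν s :=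
      ⟨_, sphereVec_mem_radial ν 0, rfl⟩
    rw [h, Submodule.mem_bot, map_eq_zero_iff _ (tensorMap_injective hs0)] at this
    exact hν.sphereVec_zero_ne_zero this
  · rw [or_iff_not_imp_left]
    intro hne
    obtain ⟨u, hu, hu0⟩ := U.ne_bot_iff.1 hne
    obtain ⟨f, ⟨g, hg⟩, rfl⟩ := hle hu
    have hf : f ≠ 0 := fun h => hu0 (by simp [h])
    obtain ⟨z, hz⟩ := Function.ne_iff.1 hf
    -- Projecting to a layer where `f` is nonzero isolates a multiple of one sphere vector;
    -- descending to `x` and climbing again recovers the whole module.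
    have h1 := hU _ (dualIdem_mem _ _ (Γ.dist x z + 1)) _ hu
    rw [dualIdem_tensorMap_succ hΓ, dualIdem_mulVec_radial hg, map_smul] at h1
    have hgz : g (Γ.dist x z) ≠ 0 := fun h => hz (by simp [hg, h])
    exact le_antisymm hle (hν.radialModule_le hΓ hS hs hU
      (hν.sphereVec_zero_mem hΓ hS hs hU _ z rfl ((U.smul_mem_iff hgz).1 h1)))

theorem endpoint_radialModule (hν : IsRegularWeight Γ x ν c a b) (hΓ : Γ.Connected)
    {s : Y → ℂ} (hs0 : s ≠ 0) :
    endpoint (graphH Γ S x) none (radialModule Γ x ν s) = 1 := by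
  have h0 : subcons (graphH Γ S x) none (radialModule Γ x ν s) 0 = ⊥ := by
    rw [eq_bot_iff]
    rintro _ ⟨_, ⟨f, -, rfl⟩, rfl⟩
    exact dualIdem_tensorMap_zero hΓ s f
  have h1 : subcons (graphH Γ S x) none (radialModule Γ x ν s) 1 ≠ ⊥ := by
    rw [Submodule.ne_bot_iff]
    refine ⟨tensorMap X s (sphereVec Γ x ν 0), ⟨_, ⟨_, sphereVec_mem_radial ν 0, rfl⟩, ?_⟩, ?_⟩
    · rw [Matrix.mulVecLin_apply, dualIdem_tensorMap_succ hΓ]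
      congr 1
      ext z
      rw [dualIdem_mulVec, sphereVec]
      split_ifs <;> rfl
    · rw [Ne, map_eq_zero_iff _ (tensorMap_injective hs0)]
      exact hν.sphereVec_zero_ne_zero
  refine le_antisymm (Nat.sInf_le h1) (Nat.one_le_iff_ne_zero.2 fun h => ?_)
  have := Nat.sInf_mem (s := {i | subcons (graphH Γ S x) none (radialModule Γ x ν s) i ≠ ⊥})
    ⟨1, h1⟩
  rw [show sInf _ = 0 from h] at this
  exact this h0

/-- The isomorphism is `f ⊗ s ↦ f ⊗ s'`. -/
theorem tIsomorphic_radialModule (hν : IsRegularWeight Γ x ν c a b) (hΓ : Γ.Connected)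
    (hS : ∀ y y', S.Adj y y' ↔ y ≠ y')
    {s s' : Y → ℂ} (hs : ∑ y, s y = 0) (hs0 : s ≠ 0) (hs' : ∑ y, s' y = 0) (hs0' : s' ≠ 0) :
    TIsomorphic (graphH Γ S x) none (radialModule Γ x ν s) (radialModule Γ x ν s') := by
  let e : radial Γ x ν ≃ₗ[ℂ] radialModule Γ x ν s :=
    Submodule.equivMapOfInjective _ (tensorMap_injective hs0) _
  let e' : radial Γ x ν ≃ₗ[ℂ] radialModule Γ x ν s' :=
    Submodule.equivMapOfInjective _ (tensorMap_injective hs0') _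
  refine ⟨e.symm.trans e', fun B hB w v hwv => ?_⟩
  obtain ⟨β, -, hB⟩ := exists_matrix_of_mem_terwilliger hΓ hS (radial Γ x ν)
    (fun _ => hν.adjM_mem_radial) (fun i _ hf => dualIdem_mem_radial hf i) hB
  obtain ⟨f, rfl⟩ := e.surjective w
  obtain ⟨f', rfl⟩ := e.surjective v
  change tensorMap X s f' = B *ᵥ tensorMap X s f at hwv
  rw [hB s hs] at hwv
  rw [LinearEquiv.trans_apply, LinearEquiv.trans_apply, e.symm_apply_apply, e.symm_apply_apply]
  change tensorMap X s' f' = B *ᵥ tensorMap X s' f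
  rw [hB s' hs', tensorMap_injective hs0 hwv]

theorem exists_eq_radialModule (hν : IsRegularWeight Γ x ν c a b) (hΓ : Γ.Connected)
    (hS : ∀ y y', S.Adj y y' ↔ y ≠ y')
    {W : Submodule ℂ (Option (X × Y) → ℂ)} (hW : IsIrredTModule (graphH Γ S x) none W)
    (hend : endpoint (graphH Γ S x) none W = 1) :
    ∃ s : Y → ℂ, ∑ y, s y = 0 ∧ s ≠ 0 ∧ radialModule Γ x ν s = W := by
  classical
  have h1 : subcons (graphH Γ S x) none W 1 ≠ ⊥ := by
    -- Otherwise the endpoint would be `sInf ∅ = 0`.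
    have hne : {i | subcons (graphH Γ S x) none W i ≠ ⊥}.Nonempty := by
      by_contra h
      rw [Set.not_nonempty_iff_eq_empty] at h
      simp [endpoint, h] at hend
    have := Nat.sInf_mem hne
    rwa [show sInf _ = 1 from hend] at this
  have h0 : subcons (graphH Γ S x) none W 0 = ⊥ := by
    by_contra h
    have : endpoint (graphH Γ S x) none W ≤ 0 := Nat.sInf_le h
    omega
  obtain ⟨_, ⟨u, hu, rfl⟩, hv0⟩ := (Submodule.ne_bot_iff _).1 h1
  rw [Matrix.mulVecLin_apply] at hv0
  set v := dualIdem (graphH Γ S x) none 1 *ᵥ u with hv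
  have hvW : v ∈ W := hW.1 _ (dualIdem_mem _ _ 1) _ hu
  -- The factor compensates for `sphereVec Γ x ν 0` being `ν x` times the indicator of `x`.
  set s : Y → ℂ := fun y => v (some (x, y)) * (ν x)⁻¹ with hsdef
  have hvs : tensorMap X s (sphereVec Γ x ν 0) = v := by
    ext (_ | ⟨z, y⟩)
    · rw [hv, dualIdem_mulVec]
      simp
    · rw [tensorMap_some, sphereVec]
      by_cases hz : x = z
      · subst hz
        simp only [SimpleGraph.dist_self, if_true, hsdef]
        rw [mul_left_comm, mul_inv_cancel₀ (hν.ne_zero x), mul_one]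
      · have : Γ.dist x z ≠ 0 := fun h => hz (hΓ.dist_eq_zero_iff.1 h)
        rw [hv, dualIdem_mulVec, dist_none_some hΓ]
        simp [this]
  -- The entry of `A v` at the new vertex is the sum of `v` over the copies of `x`, and it must
  -- vanish because the zeroth layer of `W` is zero.
  have hs : ∑ y, s y = 0 := by
    have h2 : dualIdem (graphH Γ S x) none 0 *ᵥ (adjM (graphH Γ S x) *ᵥ v) ∈
        subcons (graphH Γ S x) none W 0 := ⟨_, hW.1 _ (adjM_mem _ _) _ hvW, rfl⟩
    rw [h0, Submodule.mem_bot] at h2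
    have h3 := congrFun h2 none
    rw [dualIdem_mulVec, SimpleGraph.dist_self, if_pos rfl, adjM_mulVec, Fintype.sum_option,
      Fintype.sum_prod_type_right] at h3
    simp only [graphH_adj_none_some, SimpleGraph.irrefl, if_false, zero_add, Finset.sum_ite_eq',
      Finset.mem_univ, if_true, Pi.zero_apply] at h3
    rw [hsdef, ← Finset.sum_mul, h3, zero_mul]
  have hs0 : s ≠ 0 := by
    intro h
    apply hv0
    rw [← hvs, h]
    ext (_ | p) <;> simp
  refine ⟨s, hs, hs0, ?_⟩
  have hirr := hν.isIrredTModule_radialModule hΓ hS hs hs0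
  exact (hW.2.2 _ hirr.1 (hν.radialModule_le hΓ hS hs hW.1 (hvs ▸ hvW))).resolve_left hirr.2.1

end IsRegularWeight

end Modules
end TerwAlg

/-! ### The proposition -/

theorem proposition7p5 {X Y : Type*} [Fintype X] [DecidableEq X] [Fintype Y] [DecidableEq Y]
    (Γ : SimpleGraph X) (x : X) (hconn : Γ.Connected)
    (hpdr : TerwAlg.IsPseudoDistanceRegularAround Γ x)
    (S : SimpleGraph Y) (n : ℕ) (hn : 2 ≤ n)
    (hS : Nonempty (S ≃g (⊤ : SimpleGraph (Fin n)))) :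
    -- up to isomorphism exactly one irreducible `T(w)`-module with endpoint 1, and it is thin
    (∃ W : Submodule ℂ (Option (X × Y) → ℂ),
      (TerwAlg.IsIrredTModule (TerwAlg.graphH Γ S x) none W ∧
        TerwAlg.endpoint (TerwAlg.graphH Γ S x) none W = 1) ∧
      TerwAlg.IsThin (TerwAlg.graphH Γ S x) none W ∧
      ∀ W' : Submodule ℂ (Option (X × Y) → ℂ),
        TerwAlg.IsIrredTModule (TerwAlg.graphH Γ S x) none W' →
        TerwAlg.endpoint (TerwAlg.graphH Γ S x) none W' = 1 →
        TerwAlg.TIsomorphic (TerwAlg.graphH Γ S x) none W W') ∧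
    -- the scalars `α_i, β_i` of `Γ` exist, and with them the combinatorial conditions hold
    (∃ α β : ℕ → ℂ, TerwAlg.LocalScalars Γ x α β) ∧
    (∀ α β : ℕ → ℂ, TerwAlg.LocalScalars Γ x α β →
      TerwAlg.CombConditions (TerwAlg.graphH Γ S x) none
        (fun i => α (i - 1)) (fun _ => 0) (fun i => β (i - 1) - 1) (fun _ => 1)) := by
  obtain ⟨φ⟩ := hS
  have hS : ∀ y y', S.Adj y y' ↔ y ≠ y' := fun y y' => by
    rw [← φ.map_adj_iff, SimpleGraph.top_adj, φ.injective.ne_iff]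
  refine ⟨?_, TerwAlg.exists_localScalars hconn hpdr,
    fun α β h => TerwAlg.combConditions_graphH hconn hS h⟩
  obtain ⟨ν, h1, c, a, b, h2, h3, h4, h5, h6⟩ := hpdr.exists_weight
  have hν : TerwAlg.IsRegularWeight Γ x ν c a b := ⟨h1, h2, h3, h4, h5, h6⟩
  have hne : φ.symm ⟨0, by omega⟩ ≠ φ.symm ⟨1, by omega⟩ := by simp
  -- A nonzero vector with sum zero; two distinct vertices exist because `n ≥ 2`.
  let s : Y → ℂ := Pi.single (φ.symm ⟨0, by omega⟩) 1 - Pi.single (φ.symm ⟨1, by omega⟩) 1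
  have hs : ∑ y, s y = 0 := by simp [s]
  have hs0 : s ≠ 0 := fun h => by
    have := congrFun h (φ.symm ⟨0, by omega⟩)
    simp [s, hne] at this
  refine ⟨TerwAlg.radialModule Γ x ν s,
    ⟨hν.isIrredTModule_radialModule hconn hS hs hs0, hν.endpoint_radialModule hconn hs0⟩,
    TerwAlg.isThin_radialModule hconn s, fun W' hW' hend => ?_⟩
  obtain ⟨s', hs', hs0', rfl⟩ := hν.exists_eq_radialModule hconn hS hW' hend
  exact hν.tIsomorphic_radialModule hconn hS hs hs0 hs' hs0'
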